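/- Let $H^\infty$ be the algebra of bounded holomorphic functions on the open unit disc $\mathbb D$, and for an ideal $I$ of $H^\infty$ let $ki(I)=\bigcap_{n\ge 1} I^n$. For $z_0\in\mathbb D$ put $M_{z_0}=\{f\in H^\infty: f(z_0)=0\}$. Call $I$ free if the functions in $I$ have no common zero in $\mathbb D$. For a sequence $(a_n)_{n\ge 1}$ in $\mathbb D$ (repetitions allowed) with $\sum_n(1-|a_n|)<\infty$, the Blaschke product with zero sequence $(a_n)$ is $B(z)=\prod_{n} b_{a_n}(z)$, where $b_a(z)=\frac{|a|}{a}\,\frac{a-z}{1-\overline a z}$ for $a\neq 0$ and $b_0(z)=z$. (a) Let $P\neq\{0\}$ be a prime ideal of $H^\infty$. Then $ki(P)=\{0\}$ if and only if $P$ is a maximal ideal of the form $M_{z_0}$ for some $z_0\in\mathbb D$. (b) Let $P$ be a free prime ideal of $H^\infty$. Then every nonzero $f\in P$ has a divisor $u\in P$ that is either a Blaschke product with an infinite zero sequence, or a zero-free function with $\|u\|_\infty\le 1$. In each of these two cases a nonzero element of $ki(P)$ is obtained as follows. (b1) Let $B\in P$ be the Blaschke product with zero sequence $(a_n)_{n\ge1}$.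 There are indices $N_1,N_2,\dots$ such that $\sum_{n\ge N_k}(1-|a_n|^2)\le 2^{-k}$ for all $k\ge 1$. For every such choice, the Blaschke products $B_k$ with zero sequences $(a_n)_{n\ge N_k}$ belong to $P$, the product $B_*=\prod_{k\ge1} B_k$ converges locally uniformly on $\mathbb D$ to a function in $H^\infty$, and $0\ne B_*\in ki(P)$. (b2) Let $g\in P$ be zero-free with $\|g\|_\infty\le 1$. There are positive integers $n_1<n_2<\cdots$ and functions $g_k\in H^\infty$ with $g_k^{n_k}=g$ (that is, $g_k$ is a root $g^{1/n_k}$) such that $\sup_{|z|\le 1-1/k}|1-g_k(z)|<2^{-k}$ for all $k\ge1$. For all positive integers $n_k$ and all $g_k\in H^\infty$ with $g_k^{n_k}=g$ that satisfy these bounds, every $g_k$ belongs to $P$, the product $h=\prod_{k\ge1} g_k$ converges locally uniformly on $\mathbb D$ to a function in $H^\infty$, and $0\ne h\in ki(P)$. -/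

import Mathlib

open scoped Complex.UnitDisc ComplexConjugate

/-- The algebra `H^∞(𝔻)` of bounded holomorphic functions on the open unit disc. A function on `𝔻`
is holomorphic when it is the restriction of a function on `ℂ` that is complex differentiable at
every point of the open unit ball. -/
def HInfty : Subalgebra ℂ (𝔻 → ℂ) where
  carrier := {f | (∃ F : ℂ → ℂ, DifferentiableOn ℂ F (Metric.ball 0 1) ∧ ∀ z : 𝔻, f z = F z) ∧
    ∃ C : ℝ, ∀ z : 𝔻, ‖f z‖ ≤ C}
  mul_mem' := by
    rintro f g ⟨⟨F, hF, hfF⟩, C, hC⟩ ⟨⟨G, hG, hgG⟩, D, hD⟩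
    refine ⟨⟨F * G, hF.mul hG, fun z => by simp [hfF, hgG]⟩, C * D, fun z => ?_⟩
    rw [Pi.mul_apply, norm_mul]
    exact mul_le_mul (hC z) (hD z) (norm_nonneg _) ((norm_nonneg _).trans (hC z))
  add_mem' := by
    rintro f g ⟨⟨F, hF, hfF⟩, C, hC⟩ ⟨⟨G, hG, hgG⟩, D, hD⟩
    refine ⟨⟨F + G, hF.add hG, fun z => by simp [hfF, hgG]⟩, C + D, fun z => ?_⟩
    exact (norm_add_le _ _).trans (add_le_add (hC z) (hD z))
  algebraMap_mem' := fun c =>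
    ⟨⟨fun _ => c, differentiableOn_const c, fun _ => rfl⟩, ‖c‖, fun _ => le_rfl⟩

/-- The Krull intersection `ki(I) = ⋂_{n ≥ 1} I ^ n`. -/
def krullIntersection {R : Type*} [CommRing R] (I : Ideal R) : Ideal R :=
  ⨅ n : ℕ, I ^ (n + 1)

namespace HInfty

/-- The ideal `M_{z₀}` of all functions in `H^∞(𝔻)` that vanish at `z₀`. -/
def pointIdeal (z₀ : 𝔻) : Ideal HInfty where
  carrier := {f | (f : 𝔻 → ℂ) z₀ = 0}
  add_mem' := by
    intro f g hf hg
    change (f : 𝔻 → ℂ) z₀ = 0 at hf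
    change (g : 𝔻 → ℂ) z₀ = 0 at hg
    change (f : 𝔻 → ℂ) z₀ + (g : 𝔻 → ℂ) z₀ = 0
    rw [hf, hg, add_zero]
  zero_mem' := rfl
  smul_mem' := by
    intro c f hf
    change (f : 𝔻 → ℂ) z₀ = 0 at hf
    change (c : 𝔻 → ℂ) z₀ * (f : 𝔻 → ℂ) z₀ = 0
    rw [hf, mul_zero]

/-- The set of common zeros in `𝔻` of the functions in an ideal. -/
def zeroSet (I : Ideal HInfty) : Set 𝔻 :=
  {z | ∀ f ∈ I, (f : 𝔻 → ℂ) z = 0}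

/-- An ideal is free if its functions have no common zero in `𝔻`. -/
def IsFree (I : Ideal HInfty) : Prop :=
  zeroSet I = ∅

/-- `f` has no zero in `𝔻`. -/
def ZeroFree (f : HInfty) : Prop :=
  ∀ z : 𝔻, (f : 𝔻 → ℂ) z ≠ 0

/-- The factor with its zero at `a` of a Blaschke product. -/
noncomputable def blaschkeFactor (a z : 𝔻) : ℂ :=
  if (a : ℂ) = 0 then (z : ℂ) else (‖(a : ℂ)‖ / a) * ((a - z) / (1 - conj (a : ℂ) * z))

/-- `B` is the Blaschke product with the infinite zero sequence `a` (repeated according to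
multiplicity), which satisfies the Blaschke condition `∑ (1 - |a n|) < ∞`. -/
def IsBlaschkeProduct (a : ℕ → 𝔻) (B : HInfty) : Prop :=
  Summable (fun n => 1 - ‖(a n : ℂ)‖) ∧
    ∀ z : 𝔻, HasProd (fun n => blaschkeFactor (a n) z) ((B : 𝔻 → ℂ) z)

end HInfty

/-! The ideal `pointIdeal z₀` is generated by the Blaschke factor b at z₀, and dividing by b does
not raise a sup-norm bound (`norm_le_of_norm_blaschke_mul_le`, from the Schwarz lemma). A function
divisible by every b ^ n is therefore at most C |b| ^ n for all n, hence zero. A nonzero prime ideal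
P with a common zero is such an ideal: write f ∈ P as b ^ n g with g nonzero at that point; then g ∉
P, so b ∈ P.

A free prime ideal contains no Blaschke factor. An infinite product of f_k ∈ P whose tails stay in
H^∞ lies in every power of P: split off finitely many factors
(`NormallyMultipliable.mem_krullIntersection`). So it suffices to find f_k ∈ P tending to 1 fast,
with nonzero product. Primeness supplies them as tails of a Blaschke product in P, or as roots of a
zero-free function in P.

One of the two is always available (`exists_dvd_of_mem_of_isFree`): if no divisor of f in P is
zero-free, zeros of least modulus can be divided out forever, giving f = B G with G zero-free,
whence B ∈ P. -/

namespace HInfty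

open Filter Topology Metric

/-! ### Bounded holomorphic functions -/

/-- The restriction to `𝔻` of a function on `ℂ` that is holomorphic and bounded on the disc. -/
def ofDifferentiableOn (F : ℂ → ℂ) (hF : DifferentiableOn ℂ F (ball 0 1)) (C : ℝ)
    (hC : ∀ z : 𝔻, ‖F z‖ ≤ C) : HInfty :=
  ⟨fun z => F z, ⟨F, hF, fun _ => rfl⟩, C, hC⟩

@[simp] theorem ofDifferentiableOn_apply {F : ℂ → ℂ} {hF : DifferentiableOn ℂ F (ball 0 1)}
    {C : ℝ} {hC : ∀ z : 𝔻, ‖F z‖ ≤ C} (z : 𝔻) :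
    (ofDifferentiableOn F hF C hC : 𝔻 → ℂ) z = F z := rfl

/-- A function on `ℂ` that is holomorphic on the unit disc and restricts to `f`. -/
noncomputable def lift (f : HInfty) : ℂ → ℂ := f.2.1.choose

theorem differentiableOn_lift (f : HInfty) : DifferentiableOn ℂ (lift f) (ball 0 1) :=
  f.2.1.choose_spec.1

theorem lift_coe (f : HInfty) (z : 𝔻) : lift f z = (f : 𝔻 → ℂ) z :=
  (f.2.1.choose_spec.2 z).symm

theorem lift_of_norm_lt_one (f : HInfty) {z : ℂ} (hz : ‖z‖ < 1) :
    lift f z = (f : 𝔻 → ℂ) (.mk z hz) := lift_coe f (.mk z hz)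

theorem exists_norm_le (f : HInfty) : ∃ C : ℝ, ∀ z : 𝔻, ‖(f : 𝔻 → ℂ) z‖ ≤ C := f.2.2

@[ext] theorem ext {f g : HInfty} (h : ∀ z : 𝔻, (f : 𝔻 → ℂ) z = (g : 𝔻 → ℂ) z) : f = g :=
  Subtype.ext (funext h)

@[simp] theorem mul_apply (f g : HInfty) (z : 𝔻) :
    ((f * g : HInfty) : 𝔻 → ℂ) z = (f : 𝔻 → ℂ) z * (g : 𝔻 → ℂ) z := rfl

@[simp] theorem pow_apply (f : HInfty) (n : ℕ) (z : 𝔻) :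
    ((f ^ n : HInfty) : 𝔻 → ℂ) z = (f : 𝔻 → ℂ) z ^ n := rfl

@[simp] theorem prod_apply {ι : Type*} (s : Finset ι) (f : ι → HInfty) (z : 𝔻) :
    ((∏ i ∈ s, f i : HInfty) : 𝔻 → ℂ) z = ∏ i ∈ s, (f i : 𝔻 → ℂ) z := by
  rw [SubmonoidClass.coe_finsetProd, Finset.prod_apply]

theorem continuous_coe (f : HInfty) : Continuous (f : 𝔻 → ℂ) := by
  have h : (f : 𝔻 → ℂ) = fun z : 𝔻 => lift f z := funext fun z => (lift_coe f z).symm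
  rw [h]
  exact (differentiableOn_lift f).continuousOn.comp_continuous
    Complex.UnitDisc.continuous_coe fun z => mem_ball_zero_iff.2 z.norm_lt_one

theorem exists_apply_ne_zero {f : HInfty} (hf : f ≠ 0) : ∃ z : 𝔻, (f : 𝔻 → ℂ) z ≠ 0 := by
  by_contra! h
  exact hf (ext h)

/-! ### Blaschke factors -/

theorem one_sub_conj_mul_ne_zero {a z : ℂ} (ha : ‖a‖ < 1) (hz : ‖z‖ < 1) :
    1 - conj a * z ≠ 0 := by
  intro h
  have h1 : ‖conj a * z‖ = 1 := by rw [← sub_eq_zero.1 h, norm_one]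
  rw [norm_mul, Complex.norm_conj] at h1
  nlinarith [norm_nonneg a, norm_nonneg z]

/-- The involution of the disc that exchanges `0` and `a`. -/
noncomputable def moebius (a z : ℂ) : ℂ := (a - z) / (1 - conj a * z)

theorem differentiableOn_moebius {a : ℂ} (ha : ‖a‖ < 1) :
    DifferentiableOn ℂ (moebius a) (ball 0 1) := by
  refine DifferentiableOn.div (by fun_prop) (by fun_prop) fun z hz => ?_
  exact one_sub_conj_mul_ne_zero ha (mem_ball_zero_iff.1 hz)

theorem one_sub_norm_moebius_sq {a z : ℂ} (ha : ‖a‖ < 1) (hz : ‖z‖ < 1) :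
    1 - ‖moebius a z‖ ^ 2 = (1 - ‖a‖ ^ 2) * (1 - ‖z‖ ^ 2) / ‖1 - conj a * z‖ ^ 2 := by
  have h : ‖1 - conj a * z‖ ^ 2 ≠ 0 :=
    pow_ne_zero _ (norm_ne_zero_iff.2 (one_sub_conj_mul_ne_zero ha hz))
  rw [moebius, norm_div, div_pow, eq_div_iff h, sub_mul, div_mul_cancel₀ _ h]
  simp only [← Complex.normSq_eq_norm_sq, Complex.normSq_apply]
  simp
  ring

theorem norm_moebius_lt_one {a z : ℂ} (ha : ‖a‖ < 1) (hz : ‖z‖ < 1) : ‖moebius a z‖ < 1 := by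
  have h := one_sub_norm_moebius_sq ha hz
  have : 0 < (1 - ‖a‖ ^ 2) * (1 - ‖z‖ ^ 2) / ‖1 - conj a * z‖ ^ 2 := by
    have h1 := norm_pos_iff.2 (one_sub_conj_mul_ne_zero ha hz)
    have h2 : 0 < 1 - ‖a‖ ^ 2 := by nlinarith [norm_nonneg a]
    have h3 : 0 < 1 - ‖z‖ ^ 2 := by nlinarith [norm_nonneg z]
    positivity
  nlinarith [norm_nonneg (moebius a z)]

theorem moebius_moebius {a z : ℂ} (ha : ‖a‖ < 1) (hz : ‖z‖ < 1) :
    moebius a (moebius a z) = z := by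
  have h := one_sub_conj_mul_ne_zero ha hz
  have h2 := one_sub_conj_mul_ne_zero ha (norm_moebius_lt_one ha hz)
  rw [moebius, div_eq_iff h2, moebius]
  linear_combination -div_mul_cancel₀ (a - z) h

/-- Norm estimates do not see the normalizing constant, so this removes the case split at a = 0. The
normalization matters only for closeness to 1. -/
theorem blaschkeFactor_eq_moebius (a : 𝔻) :
    ∃ c : ℂ, ‖c‖ = 1 ∧ ∀ z : 𝔻, blaschkeFactor a z = c * moebius a z := by
  by_cases ha : (a : ℂ) = 0
  · refine ⟨-1, by simp, fun z => ?_⟩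
    simp [blaschkeFactor, moebius, ha]
  · refine ⟨‖(a : ℂ)‖ / a, ?_, fun z => ?_⟩
    · rw [norm_div, Complex.norm_real, norm_norm, div_self (norm_ne_zero_iff.2 ha)]
    · simp [blaschkeFactor, moebius, ha]

theorem norm_blaschkeFactor (a z : 𝔻) : ‖blaschkeFactor a z‖ = ‖moebius a z‖ := by
  obtain ⟨c, hc, h⟩ := blaschkeFactor_eq_moebius a
  rw [h, norm_mul, hc, one_mul]

theorem norm_blaschkeFactor_lt_one (a z : 𝔻) : ‖blaschkeFactor a z‖ < 1 := by
  rw [norm_blaschkeFactor]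
  exact norm_moebius_lt_one a.norm_lt_one z.norm_lt_one

theorem blaschkeFactor_eq_zero_iff {a z : 𝔻} : blaschkeFactor a z = 0 ↔ z = a := by
  rw [← norm_eq_zero, norm_blaschkeFactor, norm_eq_zero, moebius, div_eq_zero_iff,
    or_iff_left (one_sub_conj_mul_ne_zero a.norm_lt_one z.norm_lt_one), sub_eq_zero,
    Complex.UnitDisc.coe_inj, eq_comm]

/-- For a ≠ 0 the normalization yields b_a(z) - 1 = -(1 - |a|)(1 + |a| z / a) / (1 - āz). This makes
Blaschke products converge normally. -/
theorem norm_blaschkeFactor_sub_one_le (a z : 𝔻) :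
    ‖blaschkeFactor a z - 1‖ ≤ 2 / (1 - ‖(z : ℂ)‖) * (1 - ‖(a : ℂ)‖) := by
  have hz := z.norm_lt_one
  have ha := a.norm_lt_one
  have hz' : 0 < 1 - ‖(z : ℂ)‖ := sub_pos.2 hz
  by_cases h0 : (a : ℂ) = 0
  · rw [blaschkeFactor, if_pos h0, h0, norm_zero, sub_zero, mul_one, le_div_iff₀ hz']
    have : ‖(z : ℂ) - 1‖ ≤ ‖(z : ℂ)‖ + 1 := by simpa using norm_sub_le (z : ℂ) 1
    nlinarith [norm_nonneg (z : ℂ)]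
  · have hd := one_sub_conj_mul_ne_zero ha hz
    have hconj : conj (a : ℂ) = (‖(a : ℂ)‖ : ℂ) ^ 2 / a := by
      rw [eq_div_iff h0, mul_comm, Complex.mul_conj, Complex.normSq_eq_norm_sq]
      push_cast; rfl
    have key : blaschkeFactor a z - 1
        = -((1 - ‖(a : ℂ)‖ : ℂ) * (1 + ‖(a : ℂ)‖ / a * z)) / (1 - conj (a : ℂ) * z) := by
      rw [blaschkeFactor, if_neg h0, eq_div_iff hd, sub_mul, mul_assoc, div_mul_cancel₀ _ hd,
        hconj]
      field_simp
      ring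
    have h1 : ‖(1 - ‖(a : ℂ)‖ : ℂ)‖ = 1 - ‖(a : ℂ)‖ := by
      rw [← Complex.ofReal_one, ← Complex.ofReal_sub, Complex.norm_real, Real.norm_eq_abs,
        abs_of_pos (sub_pos.2 ha)]
    have h2 : ‖1 + (‖(a : ℂ)‖ : ℂ) / a * z‖ ≤ 2 := by
      refine (norm_add_le _ _).trans ?_
      rw [norm_mul, norm_div, Complex.norm_real, norm_norm, div_self (norm_ne_zero_iff.2 h0),
        norm_one]
      linarith
    have h3 : 1 - ‖(z : ℂ)‖ ≤ ‖1 - conj (a : ℂ) * z‖ := by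
      have := norm_sub_norm_le (1 : ℂ) (conj (a : ℂ) * z)
      rw [norm_one, norm_mul, Complex.norm_conj] at this
      nlinarith [norm_nonneg (a : ℂ), norm_nonneg (z : ℂ)]
    rw [key, norm_div, norm_neg, norm_mul, h1, div_mul_eq_mul_div (2 : ℝ), mul_comm (2 : ℝ)]
    have := sub_pos.2 ha
    gcongr

/-- The converse estimate: values at one fixed z control 1 - |a|. It yields the Blaschke condition
from a lower bound on partial products at z. -/
theorem one_sub_norm_blaschkeFactor_sq_ge (a z : 𝔻) :
    (1 - ‖(a : ℂ)‖) * ((1 - ‖(z : ℂ)‖ ^ 2) / 4) ≤ 1 - ‖blaschkeFactor a z‖ ^ 2 := by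
  have hz := z.norm_lt_one
  have ha := a.norm_lt_one
  have hd := norm_pos_iff.2 (one_sub_conj_mul_ne_zero ha hz)
  rw [norm_blaschkeFactor, one_sub_norm_moebius_sq ha hz, le_div_iff₀ (by positivity)]
  have h1 : ‖1 - conj (a : ℂ) * z‖ ≤ 2 := by
    refine (norm_sub_le _ _).trans ?_
    rw [norm_one, norm_mul, Complex.norm_conj]
    nlinarith [norm_nonneg (a : ℂ), norm_nonneg (z : ℂ)]
  have h2 : 0 ≤ (1 - ‖(a : ℂ)‖) * (1 - ‖(z : ℂ)‖ ^ 2) :=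
    mul_nonneg (by linarith) (by nlinarith [norm_nonneg (z : ℂ)])
  have h3 : ‖1 - conj (a : ℂ) * z‖ ^ 2 ≤ 4 := by nlinarith
  calc _ = ((1 - ‖(a : ℂ)‖) * (1 - ‖(z : ℂ)‖ ^ 2)) * (‖1 - conj (a : ℂ) * z‖ ^ 2 / 4) := by ring
    _ ≤ ((1 - ‖(a : ℂ)‖) * (1 - ‖(z : ℂ)‖ ^ 2)) * 1 := by gcongr; linarith
    _ ≤ ((1 - ‖(a : ℂ)‖) * (1 - ‖(z : ℂ)‖ ^ 2)) * (1 + ‖(a : ℂ)‖) := by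
        gcongr; linarith [norm_nonneg (a : ℂ)]
    _ = _ := by ring

/-- The Blaschke factor with its zero at `a`, as an element of `H^∞`. -/
noncomputable def blaschke (a : 𝔻) : HInfty :=
  ⟨blaschkeFactor a, by
    obtain ⟨c, -, h⟩ := blaschkeFactor_eq_moebius a
    exact ⟨fun z => c * moebius a z, (differentiableOn_moebius a.norm_lt_one).const_mul c, h⟩,
    1, fun z => (norm_blaschkeFactor_lt_one a z).le⟩

@[simp] theorem blaschke_apply (a z : 𝔻) : (blaschke a : 𝔻 → ℂ) z = blaschkeFactor a z := rfl

theorem blaschke_dvd_of_apply_eq_zero {f : HInfty} {a : 𝔻} (hf : (f : 𝔻 → ℂ) a = 0) :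
    blaschke a ∣ f := by
  obtain ⟨c, hc, hb⟩ := blaschkeFactor_eq_moebius a
  have hc0 : c ≠ 0 := norm_ne_zero_iff.1 (by rw [hc]; exact one_ne_zero)
  obtain ⟨C, hC⟩ := exists_norm_le f
  have hball : ball (0 : ℂ) 1 ∈ 𝓝 (a : ℂ) :=
    isOpen_ball.mem_nhds (mem_ball_zero_iff.2 a.norm_lt_one)
  -- `dslope` removes the singularity of f / (z - a); the prefactor undoes the sign, constant and
  -- denominator of the Blaschke factor.
  set F : ℂ → ℂ := fun z => -c⁻¹ * (1 - conj (a : ℂ) * z) * dslope (lift f) a z with hFdef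
  have hF : DifferentiableOn ℂ F (ball 0 1) :=
    DifferentiableOn.mul (by fun_prop)
      ((Complex.differentiableOn_dslope hball).2 (differentiableOn_lift f))
  have hmul : ∀ z : 𝔻, (f : 𝔻 → ℂ) z = blaschkeFactor a z * F z := by
    intro z
    have hd := one_sub_conj_mul_ne_zero a.norm_lt_one z.norm_lt_one
    have h := sub_smul_dslope (lift f) (a : ℂ) z
    rw [lift_coe, lift_coe, hf, sub_zero, smul_eq_mul] at h
    rw [← h, hb, moebius, hFdef]
    linear_combination dslope (lift f) a z * c * c⁻¹ * div_mul_cancel₀ ((a : ℂ) - z) hd +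
      dslope (lift f) a z * ((a : ℂ) - z) * mul_inv_cancel₀ hc0
  obtain ⟨D, hD⟩ : ∃ D, ∀ z : 𝔻, ‖F z‖ ≤ D := by
    -- Near a the quotient is bounded by continuity; at distance at least δ from a, the Blaschke
    -- factor has modulus at least δ / 2.
    obtain ⟨δ, hδ, hδb⟩ := Metric.continuousAt_iff.1 (hF.continuousOn.continuousAt hball) 1 one_pos
    refine ⟨max (‖F a‖ + 1) (C * (2 / δ)), fun z => ?_⟩
    by_cases hz : dist (z : ℂ) a < δ
    · refine le_max_of_le_left ?_
      have h1 := hδb hz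
      rw [dist_eq_norm] at h1
      have h2 := norm_sub_norm_le (F z) (F a)
      linarith
    · refine le_max_of_le_right ?_
      rw [not_lt, dist_eq_norm, norm_sub_rev] at hz
      have h1 : δ / 2 ≤ ‖blaschkeFactor a z‖ := by
        have hd := norm_pos_iff.2 (one_sub_conj_mul_ne_zero a.norm_lt_one z.norm_lt_one)
        have h2 : ‖1 - conj (a : ℂ) * z‖ ≤ 2 := by
          refine (norm_sub_le _ _).trans ?_
          rw [norm_one, norm_mul, Complex.norm_conj]
          nlinarith [norm_nonneg (a : ℂ), norm_nonneg (z : ℂ), a.norm_lt_one, z.norm_lt_one]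
        rw [norm_blaschkeFactor, moebius, norm_div]
        gcongr
      have h3 := hC z
      rw [hmul z, norm_mul] at h3
      have h4 : δ / 2 * ‖F z‖ ≤ C := le_trans (by gcongr) h3
      rw [mul_div, le_div_iff₀ hδ]
      linarith
  exact ⟨ofDifferentiableOn F hF D hD, ext hmul⟩

/-- The Schwarz lemma for f ∘ `moebius a`, which vanishes at 0, transported back because `moebius a`
is an involution. -/
theorem norm_le_mul_norm_blaschkeFactor {f : HInfty} {a : 𝔻} {C : ℝ}
    (hC : ∀ z, ‖(f : 𝔻 → ℂ) z‖ ≤ C) (hf : (f : 𝔻 → ℂ) a = 0) (z : 𝔻) :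
    ‖(f : 𝔻 → ℂ) z‖ ≤ C * ‖blaschkeFactor a z‖ := by
  have hm : Set.MapsTo (moebius a) (ball 0 1) (ball 0 1) := fun w hw =>
    mem_ball_zero_iff.2 (norm_moebius_lt_one a.norm_lt_one (mem_ball_zero_iff.1 hw))
  have h0 : (lift f ∘ moebius a) 0 = 0 := by simp [moebius, lift_coe, hf]
  have h := Complex.dist_le_div_mul_dist_of_mapsTo_ball (f := lift f ∘ moebius a) (c := 0)
    (R₁ := 1) (R₂ := C) (z := moebius a z)
    ((differentiableOn_lift f).comp (differentiableOn_moebius a.norm_lt_one) hm)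
    (fun w hw => by
      rw [h0, mem_closedBall_zero_iff, Function.comp_apply,
        lift_of_norm_lt_one f (mem_ball_zero_iff.1 (hm hw))]
      exact hC _)
    (hm (mem_ball_zero_iff.2 z.norm_lt_one))
  rw [h0, dist_zero_right, dist_zero_right, div_one, Function.comp_apply,
    moebius_moebius a.norm_lt_one z.norm_lt_one, lift_coe] at h
  rwa [norm_blaschkeFactor]

/-- Off a, cancel the Blaschke factor in the Schwarz estimate; at a, use continuity of g. -/
theorem norm_le_of_norm_blaschke_mul_le {g : HInfty} {a : 𝔻} {C : ℝ}
    (hC : ∀ z, ‖((blaschke a * g : HInfty) : 𝔻 → ℂ) z‖ ≤ C) (z : 𝔻) : ‖(g : 𝔻 → ℂ) z‖ ≤ C := by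
  have hne : ∀ w : 𝔻, w ≠ a → ‖(g : 𝔻 → ℂ) w‖ ≤ C := by
    intro w hw
    have h := norm_le_mul_norm_blaschkeFactor hC
      (a := a) (by simp [blaschkeFactor_eq_zero_iff.2 (rfl : a = a)]) w
    rw [mul_apply, norm_mul, blaschke_apply, mul_comm] at h
    exact le_of_mul_le_mul_right h (norm_pos_iff.2 (mt blaschkeFactor_eq_zero_iff.1 hw))
  rw [← lift_coe]
  have hcont : ContinuousAt (lift g) (z : ℂ) := (differentiableOn_lift g).continuousOn.continuousAt
    (isOpen_ball.mem_nhds (mem_ball_zero_iff.2 z.norm_lt_one))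
  refine le_of_tendsto (hcont.norm.tendsto.mono_left (nhdsWithin_le_nhds (s := {(z : ℂ)}ᶜ))) ?_
  have hev : ∀ᶠ w in 𝓝[≠] (z : ℂ), w ∈ ball (0 : ℂ) 1 :=
    nhdsWithin_le_nhds (isOpen_ball.mem_nhds (mem_ball_zero_iff.2 z.norm_lt_one))
  have hev2 : ∀ᶠ w : ℂ in 𝓝[≠] (z : ℂ), w ≠ a := by
    by_cases hza : (z : ℂ) = a
    · rw [← hza]; exact eventually_mem_nhdsWithin
    · exact nhdsWithin_le_nhds (isOpen_ne.mem_nhds hza)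
  filter_upwards [hev, hev2] with w hw hwa
  rw [lift_of_norm_lt_one g (mem_ball_zero_iff.1 hw)]
  exact hne _ fun h => hwa (by rw [← h, Complex.UnitDisc.coe_mk])

theorem norm_le_of_norm_blaschke_pow_mul_le {g : HInfty} {a : 𝔻} {C : ℝ} (n : ℕ)
    (hC : ∀ z, ‖((blaschke a ^ n * g : HInfty) : 𝔻 → ℂ) z‖ ≤ C) (z : 𝔻) :
    ‖(g : 𝔻 → ℂ) z‖ ≤ C := by
  induction n with
  | zero => simpa using hC z
  | succ n ih =>
    refine ih fun w => norm_le_of_norm_blaschke_mul_le (a := a) (fun w => ?_) w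
    rw [← mul_assoc, ← pow_succ']
    exact hC w

theorem eq_zero_of_forall_blaschke_pow_dvd {f : HInfty} {a : 𝔻}
    (h : ∀ n : ℕ, blaschke a ^ n ∣ f) : f = 0 := by
  obtain ⟨C, hC⟩ := exists_norm_le f
  ext z
  have hlim : Tendsto (fun n : ℕ => ‖blaschkeFactor a z‖ ^ n * C) atTop (𝓝 (0 * C)) :=
    (tendsto_pow_atTop_nhds_zero_of_lt_one (norm_nonneg _)
      (norm_blaschkeFactor_lt_one a z)).mul_const C
  rw [zero_mul] at hlim
  refine norm_le_zero_iff.1 (ge_of_tendsto' hlim fun n => ?_)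
  obtain ⟨g, hg⟩ := h n
  have h1 := norm_le_of_norm_blaschke_pow_mul_le n (fun w => by rw [← hg]; exact hC w) z
  rw [hg, mul_apply, norm_mul, pow_apply, norm_pow, blaschke_apply]
  gcongr

theorem exists_eq_blaschke_pow_mul {f : HInfty} (hf : f ≠ 0) (a : 𝔻) :
    ∃ (n : ℕ) (g : HInfty), f = blaschke a ^ n * g ∧ (g : 𝔻 → ℂ) a ≠ 0 := by
  have hex : ∃ n : ℕ, ¬ blaschke a ^ n ∣ f := by
    by_contra! h
    exact hf (eq_zero_of_forall_blaschke_pow_dvd h)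
  classical
  obtain ⟨m, hm⟩ : ∃ m, Nat.find hex = m + 1 := Nat.exists_eq_succ_of_ne_zero fun h0 => by
    have := Nat.find_spec hex
    rw [h0, pow_zero] at this
    exact this (one_dvd f)
  obtain ⟨g, hg⟩ := not_not.1 (Nat.find_min hex (m := m) (by omega))
  refine ⟨m, g, hg, fun h0 => ?_⟩
  have hns := Nat.find_spec hex
  rw [hm] at hns
  obtain ⟨k, hk⟩ := blaschke_dvd_of_apply_eq_zero h0
  exact hns ⟨k, by rw [hg, hk, pow_succ, mul_assoc]⟩

/-! ### Point ideals -/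

theorem mem_pointIdeal {a : 𝔻} {f : HInfty} : f ∈ pointIdeal a ↔ (f : 𝔻 → ℂ) a = 0 := Iff.rfl

theorem pointIdeal_eq_span (a : 𝔻) : pointIdeal a = Ideal.span {blaschke a} := by
  ext f
  rw [Ideal.mem_span_singleton, mem_pointIdeal]
  refine ⟨blaschke_dvd_of_apply_eq_zero, ?_⟩
  rintro ⟨g, rfl⟩
  simp [blaschkeFactor_eq_zero_iff.2 (rfl : a = a)]

theorem pointIdeal_isMaximal (a : 𝔻) : (pointIdeal a).IsMaximal := by
  have h : pointIdeal a
      = RingHom.ker ((Pi.evalRingHom (fun _ : 𝔻 => ℂ) a).comp (HInfty.val : HInfty →+* (𝔻 → ℂ))) := by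
    ext f
    rfl
  rw [h]
  exact RingHom.ker_isMaximal_of_surjective _ fun c => ⟨algebraMap ℂ HInfty c, rfl⟩

theorem krullIntersection_pointIdeal (a : 𝔻) : krullIntersection (pointIdeal a) = ⊥ := by
  refine (Submodule.eq_bot_iff _).2 fun f hf => eq_zero_of_forall_blaschke_pow_dvd (a := a) ?_
  intro n
  have h := (Submodule.mem_iInf _).1 hf n
  rw [pointIdeal_eq_span, Ideal.span_singleton_pow, Ideal.mem_span_singleton] at h
  exact (pow_dvd_pow _ n.le_succ).trans h

theorem eq_pointIdeal_of_blaschke_mem {P : Ideal HInfty} (hP : P.IsPrime) {a : 𝔻}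
    (h : blaschke a ∈ P) : P = pointIdeal a := by
  refine ((pointIdeal_isMaximal a).eq_of_le hP.ne_top ?_).symm
  rw [pointIdeal_eq_span]
  exact (Ideal.span_singleton_le_iff_mem P).2 h

theorem eq_pointIdeal_of_mem_zeroSet {P : Ideal HInfty} (hP : P.IsPrime) (hP0 : P ≠ ⊥) {a : 𝔻}
    (ha : a ∈ zeroSet P) : P = pointIdeal a := by
  obtain ⟨f, hfP, hf0⟩ := Submodule.exists_mem_ne_zero_of_ne_bot hP0
  obtain ⟨n, g, rfl, hg⟩ := exists_eq_blaschke_pow_mul hf0 a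
  rcases hP.mem_or_mem hfP with h | h
  · exact eq_pointIdeal_of_blaschke_mem hP (hP.mem_of_pow_mem n h)
  · exact absurd (ha g h) hg

theorem blaschke_notMem_of_isFree {P : Ideal HInfty} (hP : P.IsPrime) (hfree : IsFree P) (a : 𝔻) :
    blaschke a ∉ P := by
  intro h
  have ha : a ∈ zeroSet P := by
    rw [eq_pointIdeal_of_blaschke_mem hP h]
    exact fun f hf => hf
  rw [hfree] at ha
  exact ha

/-! ### Infinite products -/

/-- The functions `f k` are bounded by `1` and `∑ ‖f k - 1‖` converges normally on every smaller
disc. -/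
def NormallyMultipliable (f : ℕ → HInfty) : Prop :=
  (∀ k z, ‖(f k : 𝔻 → ℂ) z‖ ≤ 1) ∧ ∀ r < (1 : ℝ), ∃ u : ℕ → ℝ, Summable u ∧
    ∀ᶠ k in atTop, ∀ z : 𝔻, ‖(z : ℂ)‖ ≤ r → ‖(f k : 𝔻 → ℂ) z - 1‖ ≤ u k

namespace NormallyMultipliable

variable {f : ℕ → HInfty}

theorem shift (hf : NormallyMultipliable f) (n : ℕ) : NormallyMultipliable fun k => f (k + n) := by
  refine ⟨fun k => hf.1 _, fun r hr => ?_⟩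
  obtain ⟨u, hu, h⟩ := hf.2 r hr
  exact ⟨fun k => u (k + n), (summable_nat_add_iff n).2 hu, (tendsto_add_atTop_nat n).eventually h⟩

theorem summable_norm (hf : NormallyMultipliable f) (z : 𝔻) :
    Summable fun k => ‖(f k : 𝔻 → ℂ) z - 1‖ := by
  obtain ⟨u, hu, h⟩ := hf.2 _ z.norm_lt_one
  refine hu.of_norm_bounded_eventually_nat ?_
  filter_upwards [h] with k hk
  rw [norm_norm]
  exact hk z le_rfl

theorem hasProdLocallyUniformlyOn_lift (hf : NormallyMultipliable f) :
    HasProdLocallyUniformlyOn (fun k => lift (f k)) (fun z => ∏' k, lift (f k) z) (ball 0 1) := by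
  refine hasProdLocallyUniformlyOn_of_forall_compact isOpen_ball fun K hK hKc => ?_
  obtain ⟨r, hr, hKr⟩ : ∃ r < (1 : ℝ), ∀ z ∈ K, ‖z‖ ≤ r := by
    rcases K.eq_empty_or_nonempty with rfl | hne
    · exact ⟨0, one_pos, by simp⟩
    · obtain ⟨w, hw, hmax⟩ := hKc.exists_isMaxOn hne continuous_norm.continuousOn
      exact ⟨‖w‖, mem_ball_zero_iff.1 (hK hw), fun z hz => hmax hz⟩
  obtain ⟨u, hu, h⟩ := hf.2 r hr
  have := Summable.hasProdUniformlyOn_nat_one_add hKc (f := fun k z => lift (f k) z - 1) hu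
    (by
      filter_upwards [h] with k hk z hz
      rw [lift_of_norm_lt_one _ ((hKr z hz).trans_lt hr)]
      exact hk _ (hKr z hz))
    (fun k => (((differentiableOn_lift (f k)).continuousOn).mono hK).sub continuousOn_const)
  simpa using this

theorem exists_hasProd (hf : NormallyMultipliable f) : ∃ F : HInfty,
    HasProdLocallyUniformly (fun k => (f k : 𝔻 → ℂ)) (F : 𝔻 → ℂ) ∧
    (∀ z, HasProd (fun k => (f k : 𝔻 → ℂ) z) ((F : 𝔻 → ℂ) z)) ∧
    ∀ z, (∀ k, (f k : 𝔻 → ℂ) z ≠ 0) → (F : 𝔻 → ℂ) z ≠ 0 := by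
  have hlu := hf.hasProdLocallyUniformlyOn_lift
  have hdiff : DifferentiableOn ℂ (fun z => ∏' k, lift (f k) z) (ball 0 1) := by
    refine TendstoLocallyUniformlyOn.differentiableOn hlu (.of_forall fun s => ?_) isOpen_ball
    exact DifferentiableOn.fun_finsetProd fun k _ => differentiableOn_lift (f k)
  have hball (z : 𝔻) : (z : ℂ) ∈ ball (0 : ℂ) 1 := mem_ball_zero_iff.2 z.norm_lt_one
  have hprod (z : 𝔻) : HasProd (fun k => (f k : 𝔻 → ℂ) z) (∏' k, lift (f k) z) := by
    have h := hlu.hasProd (hball z)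
    simpa only [lift_coe] using h
  have hnorm (z : 𝔻) : ‖∏' k, lift (f k) z‖ ≤ 1 := by
    refine le_of_tendsto' (hprod z).norm fun s => ?_
    exact Finset.prod_le_one (fun _ _ => norm_nonneg _) fun k _ => hf.1 k z
  refine ⟨ofDifferentiableOn _ hdiff 1 hnorm, ?_, hprod, fun z hz => ?_⟩
  · have h := hlu.comp ((↑) : 𝔻 → ℂ) (t := Set.univ) (fun z _ => hball z)
      Complex.UnitDisc.continuous_coe.continuousOn
    simp only [lift_coe] at h
    exact tendstoLocallyUniformlyOn_univ.1 h
  · have h := tprod_one_add_ne_zero_of_summable (f := fun k => (f k : 𝔻 → ℂ) z - 1)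
      (fun k => by simpa using hz k) (hf.summable_norm z)
    simpa [lift_coe] using h

theorem eq_prod_mul (hf : NormallyMultipliable f) {F : HInfty}
    (hF : ∀ z, HasProd (fun k => (f k : 𝔻 → ℂ) z) ((F : 𝔻 → ℂ) z)) (n : ℕ) :
    ∃ G : HInfty, (∀ z, HasProd (fun k => (f (k + n) : 𝔻 → ℂ) z) ((G : 𝔻 → ℂ) z)) ∧
      F = (∏ k ∈ Finset.range n, f k) * G := by
  obtain ⟨G, -, hG, -⟩ := (hf.shift n).exists_hasProd
  refine ⟨G, hG, ext fun z => ?_⟩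
  rw [mul_apply, prod_apply]
  exact (hF z).unique (hG z).prod_range_mul

/-- The first n + 1 factors multiply into P ^ (n + 1), and the remaining tail is a bounded
holomorphic cofactor. -/
theorem mem_krullIntersection (hf : NormallyMultipliable f) {F : HInfty}
    (hF : ∀ z, HasProd (fun k => (f k : 𝔻 → ℂ) z) ((F : 𝔻 → ℂ) z)) {P : Ideal HInfty}
    (hP : ∀ k, f k ∈ P) : F ∈ krullIntersection P := by
  have hmem (n : ℕ) : ∏ k ∈ Finset.range n, f k ∈ P ^ n := by
    induction n with
    | zero => simp
    | succ n ih =>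
      rw [Finset.prod_range_succ, pow_succ]
      exact Ideal.mul_mem_mul ih (hP n)
  refine (Submodule.mem_iInf _).2 fun n => ?_
  obtain ⟨G, -, rfl⟩ := hf.eq_prod_mul hF (n + 1)
  exact Ideal.mul_mem_right _ _ (hmem _)

end NormallyMultipliable

/-- Induction on xy - 1 = (x - 1) + x (y - 1) with |x| ≤ 1. -/
theorem norm_prod_sub_one_le {ι : Type*} (s : Finset ι) {x : ι → ℂ} (hx : ∀ i, ‖x i‖ ≤ 1) :
    ‖∏ i ∈ s, x i - 1‖ ≤ ∑ i ∈ s, ‖x i - 1‖ := by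
  classical
  induction s using Finset.induction_on with
  | empty => simp
  | insert i s hi ih =>
    rw [Finset.prod_insert hi, Finset.sum_insert hi]
    calc ‖x i * ∏ j ∈ s, x j - 1‖ = ‖(x i - 1) + x i * (∏ j ∈ s, x j - 1)‖ := by ring_nf
      _ ≤ ‖x i - 1‖ + ‖x i‖ * ‖∏ j ∈ s, x j - 1‖ := by
        rw [← norm_mul]; exact norm_add_le _ _
      _ ≤ ‖x i - 1‖ + 1 * ∑ j ∈ s, ‖x j - 1‖ := by gcongr; exact hx i
      _ = _ := by rw [one_mul]

/-! ### Blaschke products -/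

section Blaschke

variable {a : ℕ → 𝔻}

theorem normallyMultipliable_blaschke (ha : Summable fun n => 1 - ‖(a n : ℂ)‖) :
    NormallyMultipliable fun n => blaschke (a n) := by
  refine ⟨fun n z => (norm_blaschkeFactor_lt_one _ z).le, fun r hr => ?_⟩
  refine ⟨_, ha.mul_left (2 / (1 - r)), .of_forall fun n z hz => ?_⟩
  refine (norm_blaschkeFactor_sub_one_le (a n) z).trans ?_
  have h1 := (a n).norm_lt_one
  have h2 : 0 < 1 - r := by linarith
  have h3 : 0 ≤ 1 - ‖(a n : ℂ)‖ := by linarith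
  gcongr

theorem exists_isBlaschkeProduct (ha : Summable fun n => 1 - ‖(a n : ℂ)‖) :
    ∃ B, IsBlaschkeProduct a B := by
  obtain ⟨B, -, hB, -⟩ := (normallyMultipliable_blaschke ha).exists_hasProd
  exact ⟨B, ha, hB⟩

namespace IsBlaschkeProduct

variable {B : HInfty}

theorem norm_le_one (hB : IsBlaschkeProduct a B) (z : 𝔻) : ‖(B : 𝔻 → ℂ) z‖ ≤ 1 := by
  refine le_of_tendsto' (hB.2 z).norm fun s => ?_
  exact Finset.prod_le_one (fun _ _ => norm_nonneg _) fun k _ =>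
    (norm_blaschkeFactor_lt_one _ z).le

theorem apply_ne_zero (hB : IsBlaschkeProduct a B) {z : 𝔻} (hz : ∀ n, z ≠ a n) :
    (B : 𝔻 → ℂ) z ≠ 0 := by
  obtain ⟨F, -, hF, hF0⟩ := (normallyMultipliable_blaschke hB.1).exists_hasProd
  rw [(hB.2 z).unique (hF z)]
  exact hF0 z fun n => mt blaschkeFactor_eq_zero_iff.1 (hz n)

theorem exists_tail (hB : IsBlaschkeProduct a B) (n : ℕ) :
    ∃ T, IsBlaschkeProduct (fun k => a (k + n)) T ∧
      B = (∏ k ∈ Finset.range n, blaschke (a k)) * T := by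
  obtain ⟨T, hT, h⟩ := (normallyMultipliable_blaschke hB.1).eq_prod_mul hB.2 n
  exact ⟨T, ⟨(summable_nat_add_iff n).2 hB.1, hT⟩, h⟩

theorem summable_one_sub_sq (hB : IsBlaschkeProduct a B) :
    Summable fun n => 1 - ‖(a n : ℂ)‖ ^ 2 := by
  refine (hB.1.mul_left 2).of_nonneg_of_le (fun n => ?_) fun n => ?_ <;>
  nlinarith [(a n).norm_lt_one, norm_nonneg (a n : ℂ)]

theorem norm_sub_one_le (hB : IsBlaschkeProduct a B) (z : 𝔻) :
    ‖(B : 𝔻 → ℂ) z - 1‖ ≤ 2 / (1 - ‖(z : ℂ)‖) * ∑' n, (1 - ‖(a n : ℂ)‖ ^ 2) := by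
  refine le_of_tendsto' ((hB.2 z).sub_const 1).norm fun s => ?_
  have hz := sub_pos.2 z.norm_lt_one
  have hsq (n : ℕ) : 1 - ‖(a n : ℂ)‖ ≤ 1 - ‖(a n : ℂ)‖ ^ 2 := by
    nlinarith [(a n).norm_lt_one, norm_nonneg (a n : ℂ)]
  calc _ ≤ ∑ n ∈ s, ‖blaschkeFactor (a n) z - 1‖ :=
        norm_prod_sub_one_le s fun n => (norm_blaschkeFactor_lt_one (a n) z).le
    _ ≤ ∑ n ∈ s, 2 / (1 - ‖(z : ℂ)‖) * (1 - ‖(a n : ℂ)‖ ^ 2) := by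
        refine Finset.sum_le_sum fun n _ => (norm_blaschkeFactor_sub_one_le (a n) z).trans ?_
        exact mul_le_mul_of_nonneg_left (hsq n) (by positivity)
    _ = 2 / (1 - ‖(z : ℂ)‖) * ∑ n ∈ s, (1 - ‖(a n : ℂ)‖ ^ 2) := by rw [Finset.mul_sum]
    _ ≤ _ := by
        gcongr
        exact hB.summable_one_sub_sq.sum_le_tsum s fun n _ =>
          (sub_nonneg.2 (a n).norm_lt_one.le).trans (hsq n)

theorem exists_forall_ne (a : ℕ → 𝔻) : ∃ z : 𝔻, ∀ n, z ≠ a n := by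
  have h : (Set.range fun n => (a n : ℂ)).Countable := Set.countable_range _
  obtain ⟨z, hz, hza⟩ := (h.dense_compl ℂ).exists_mem_open isOpen_ball
    ⟨0, mem_ball_self (ε := 1) one_pos⟩
  rw [mem_ball_zero_iff] at hza
  exact ⟨.mk z hza, fun n hn => hz ⟨n, by simp [← hn]⟩⟩

/-- The product of the tails of a Blaschke product in a free prime ideal. -/
theorem tails_mem_krullIntersection (hB : IsBlaschkeProduct a B) {P : Ideal HInfty}
    (hP : P.IsPrime) (hfree : IsFree P) (hBP : B ∈ P) {N : ℕ → ℕ}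
    (hN : ∀ k, ∑' n, (1 - ‖(a (n + N k) : ℂ)‖ ^ 2) ≤ 1 / 2 ^ (k + 1)) :
    ∃ (T : ℕ → HInfty) (Bstar : HInfty),
      (∀ k, IsBlaschkeProduct (fun n => a (n + N k)) (T k) ∧ T k ∈ P) ∧
      HasProdLocallyUniformly (fun k => (T k : 𝔻 → ℂ)) (Bstar : 𝔻 → ℂ) ∧
      Bstar ≠ 0 ∧ Bstar ∈ krullIntersection P := by
  choose T hT hBT using fun k => hB.exists_tail (N k)
  have hTP (k : ℕ) : T k ∈ P := by
    rw [hBT k] at hBP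
    refine (hP.mem_or_mem hBP).resolve_left fun h => ?_
    obtain ⟨i, -, hi⟩ := (hP.prod_mem_iff).1 h
    exact blaschke_notMem_of_isFree hP hfree _ hi
  have hnm : NormallyMultipliable T := by
    refine ⟨fun k => (hT k).norm_le_one, fun r hr => ?_⟩
    refine ⟨fun k => 2 / (1 - r) * (1 / 2 ^ (k + 1)), ?_, .of_forall fun k z hz => ?_⟩
    · refine Summable.mul_left _ ?_
      simpa using (summable_nat_add_iff 1).2 (summable_geometric_two)
    · have h1 : 0 < 1 - r := by linarith
      have h2 : 0 < 1 - ‖(z : ℂ)‖ := by linarith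
      refine ((hT k).norm_sub_one_le z).trans ?_
      calc _ ≤ 2 / (1 - ‖(z : ℂ)‖) * (1 / 2 ^ (k + 1)) := by gcongr; exact hN k
        _ ≤ 2 / (1 - r) * (1 / 2 ^ (k + 1)) := by gcongr
  obtain ⟨Bstar, hlu, hprod, hne⟩ := hnm.exists_hasProd
  refine ⟨T, Bstar, fun k => ⟨hT k, hTP k⟩, hlu, ?_, hnm.mem_krullIntersection hprod hTP⟩
  -- The zeros are countable, so some point avoids all of them; there no tail vanishes, hence
  -- neither does their product.
  obtain ⟨z, hz⟩ := exists_forall_ne a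
  rintro rfl
  exact hne z (fun k => (hT k).apply_ne_zero fun n => hz _) rfl

theorem exists_tail_sum_le (a : ℕ → 𝔻) :
    ∃ N : ℕ → ℕ, ∀ k, ∑' n, (1 - ‖(a (n + N k) : ℂ)‖ ^ 2) ≤ 1 / 2 ^ (k + 1) := by
  -- This limit needs no summability: a divergent series has all its tails equal to 0 by the
  -- convention for `tsum`.
  have h := tendsto_sum_nat_add fun n => 1 - ‖(a n : ℂ)‖ ^ 2
  choose N hN using fun k : ℕ =>
    (h.eventually_le_const (u := 1 / 2 ^ (k + 1)) (by positivity)).exists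
  exact ⟨N, hN⟩

end IsBlaschkeProduct

end Blaschke

/-! ### Factorization -/

theorem exists_zero_of_minimal_norm {f : HInfty} (hf : ¬ ZeroFree f) :
    ∃ a : 𝔻, (f : 𝔻 → ℂ) a = 0 ∧ ∀ z : 𝔻, (f : 𝔻 → ℂ) z = 0 → ‖(a : ℂ)‖ ≤ ‖(z : ℂ)‖ := by
  obtain ⟨w, hw⟩ : ∃ w : 𝔻, (f : 𝔻 → ℂ) w = 0 := by simpa [ZeroFree] using hf
  have hsub : closedBall (0 : ℂ) ‖(w : ℂ)‖ ⊆ ball 0 1 := closedBall_subset_ball w.norm_lt_one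
  have hK : IsCompact (closedBall (0 : ℂ) ‖(w : ℂ)‖ ∩ lift f ⁻¹' {0}) :=
    (isCompact_closedBall _ _).of_isClosed_subset
      (((differentiableOn_lift f).continuousOn.mono hsub).preimage_isClosed_of_isClosed
        isClosed_closedBall isClosed_singleton) Set.inter_subset_left
  obtain ⟨a, ⟨ha, ha0⟩, hmin⟩ := hK.exists_isMinOn
    ⟨w, mem_closedBall_zero_iff.2 le_rfl, by simpa [lift_coe] using hw⟩
    continuous_norm.continuousOn
  have ha1 : ‖a‖ < 1 := mem_ball_zero_iff.1 (hsub ha)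
  refine ⟨.mk a ha1, by rw [← lift_of_norm_lt_one]; exact ha0, fun z hz => ?_⟩
  rw [Complex.UnitDisc.coe_mk]
  by_cases hzw : ‖(z : ℂ)‖ ≤ ‖(w : ℂ)‖
  · exact hmin ⟨mem_closedBall_zero_iff.2 hzw, by simpa [lift_coe] using hz⟩
  · exact (mem_closedBall_zero_iff.1 ha).trans (not_le.1 hzw).le

section

variable {h : ℕ → HInfty} {a : ℕ → 𝔻}

theorem eq_prod_blaschke_mul (hh : ∀ n, h n = blaschke (a n) * h (n + 1)) (m n : ℕ) :
    h m = (∏ i ∈ Finset.range n, blaschke (a (i + m))) * h (n + m) := by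
  induction n with
  | zero => simp
  | succ n ih =>
    rw [ih, Finset.prod_range_succ, hh (n + m), mul_assoc, add_right_comm]

theorem norm_le_of_eq_blaschke_mul (hh : ∀ n, h n = blaschke (a n) * h (n + 1)) {C : ℝ}
    (hC : ∀ z, ‖(h 0 : 𝔻 → ℂ) z‖ ≤ C) (n : ℕ) : ∀ z, ‖(h n : 𝔻 → ℂ) z‖ ≤ C := by
  induction n with
  | zero => exact hC
  | succ n ih =>
    rw [hh n] at ih
    exact norm_le_of_norm_blaschke_mul_le ih

/-- At a point z with h 0 ≠ 0, the cofactors stay bounded by C, so the partial products of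
|b_{a_i}(z)| are at least |h 0 (z)| / C. Then x ≤ exp(x - 1) with x = |b_{a_i}(z)|² bounds the sums
of 1 - |b_{a_i}(z)|². -/
theorem summable_of_eq_blaschke_mul (hh : ∀ n, h n = blaschke (a n) * h (n + 1)) (h0 : h 0 ≠ 0) :
    Summable fun n => 1 - ‖(a n : ℂ)‖ := by
  obtain ⟨z, hz⟩ := exists_apply_ne_zero h0
  obtain ⟨C, hC⟩ := exists_norm_le (h 0)
  have hpos : 0 < ‖(h 0 : 𝔻 → ℂ) z‖ := norm_pos_iff.2 hz
  have hC0 : 0 < C := hpos.trans_le (hC z)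
  have hx (n : ℕ) : 0 ≤ 1 - ‖blaschkeFactor (a n) z‖ ^ 2 := by
    nlinarith [norm_blaschkeFactor_lt_one (a n) z, norm_nonneg (blaschkeFactor (a n) z)]
  have hs : Summable fun n => 1 - ‖blaschkeFactor (a n) z‖ ^ 2 := by
    refine summable_of_sum_range_le (c := -Real.log ((‖(h 0 : 𝔻 → ℂ) z‖ / C) ^ 2)) hx fun n => ?_
    rw [le_neg, Real.log_le_iff_le_exp (by positivity), ← Finset.sum_neg_distrib, Real.exp_sum]
    have h1 : ‖(h 0 : 𝔻 → ℂ) z‖ / C ≤ ∏ i ∈ Finset.range n, ‖blaschkeFactor (a i) z‖ := by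
      rw [div_le_iff₀ hC0, eq_prod_blaschke_mul hh 0 n, mul_apply, prod_apply, norm_mul, norm_prod]
      exact mul_le_mul_of_nonneg_left (norm_le_of_eq_blaschke_mul hh hC _ z)
        (Finset.prod_nonneg fun _ _ => norm_nonneg _)
    calc _ ≤ (∏ i ∈ Finset.range n, ‖blaschkeFactor (a i) z‖) ^ 2 := by gcongr
      _ = ∏ i ∈ Finset.range n, ‖blaschkeFactor (a i) z‖ ^ 2 := (Finset.prod_pow _ _ _).symm
      _ ≤ _ := by
        refine Finset.prod_le_prod (fun _ _ => by positivity) fun i _ => ?_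
        have := Real.add_one_le_exp (-(1 - ‖blaschkeFactor (a i) z‖ ^ 2))
        linarith
  have hc : 0 < (1 - ‖(z : ℂ)‖ ^ 2) / 4 := by
    nlinarith [z.norm_lt_one, norm_nonneg (z : ℂ)]
  refine (summable_mul_right_iff hc.ne').1 (hs.of_nonneg_of_le (fun n => ?_) fun n =>
    one_sub_norm_blaschkeFactor_sq_ge (a n) z)
  exact mul_nonneg (sub_nonneg.2 (a n).norm_lt_one.le) hc.le

/-- Dividing out zeros of minimal modulus one at a time splits off a Blaschke product and leaves a
zero-free function. -/
theorem exists_eq_blaschkeProduct_mul (hh : ∀ n, h n = blaschke (a n) * h (n + 1)) (h0 : h 0 ≠ 0)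
    (hmin : ∀ n z, (h n : 𝔻 → ℂ) z = 0 → ‖(a n : ℂ)‖ ≤ ‖(z : ℂ)‖) :
    ∃ B G : HInfty, IsBlaschkeProduct a B ∧ ZeroFree G ∧ h 0 = B * G := by
  have hsum := summable_of_eq_blaschke_mul hh h0
  obtain ⟨C, hC⟩ := exists_norm_le (h 0)
  obtain ⟨B, hB⟩ := exists_isBlaschkeProduct hsum
  choose T hT hBT using hB.exists_tail
  have hTstep (n : ℕ) : T n = blaschke (a n) * T (n + 1) := by
    ext z
    have h1 := (hT (n + 1)).2 z
    have h2 : HasProd (fun k => blaschkeFactor (a (k + 1 + n)) z) ((T (n + 1) : 𝔻 → ℂ) z) := by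
      simpa only [add_assoc, add_comm 1 n] using h1
    have h3 := h2.prod_range_mul (f := fun k => blaschkeFactor (a (k + n)) z)
    rw [Finset.prod_range_one, zero_add] at h3
    exact ((hT n).2 z).unique h3
  -- Bound h n by C times its first k Blaschke factors and let k tend to infinity.
  have hbound (n : ℕ) (z : 𝔻) : ‖(h n : 𝔻 → ℂ) z‖ ≤ ‖(T n : 𝔻 → ℂ) z‖ * C := by
    refine ge_of_tendsto' ((((hT n).2 z).tendsto_prod_nat).norm.mul_const C) fun k => ?_
    rw [eq_prod_blaschke_mul hh n k, mul_apply, prod_apply, norm_mul]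
    exact mul_le_mul_of_nonneg_left (norm_le_of_eq_blaschke_mul hh hC _ z) (norm_nonneg _)
  -- The quotient of h 0 by B, defined also at the zeros of B: cancelling common factors makes the
  -- sequence eventually constant.
  set Q : ℂ → ℂ := fun z => limUnder atTop fun n => lift (h n) z / lift (T n) z with hQ
  have key (r : ℝ) (hr : r < 1) : ∃ m, ∀ z : 𝔻, ‖(z : ℂ)‖ ≤ r →
      (h m : 𝔻 → ℂ) z ≠ 0 ∧ (T m : 𝔻 → ℂ) z ≠ 0 ∧ Q z = (h m : 𝔻 → ℂ) z / (T m : 𝔻 → ℂ) z := by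
    obtain ⟨m, hm⟩ := eventually_atTop.1
      -- Since |a n| → 1, all zeros from index m on lie outside the disc of radius r; minimality of
      -- |a m| keeps every zero of h m outside too.
      (hsum.tendsto_atTop_zero.eventually_lt_const (sub_pos.2 hr))
    have hlt : ∀ n ≥ m, r < ‖(a n : ℂ)‖ := fun n hn => by linarith [hm n hn]
    refine ⟨m, fun z hz => ⟨fun h1 => ?_, (hT m).apply_ne_zero fun n h1 => ?_, ?_⟩⟩
    · linarith [hmin m z h1, hlt m le_rfl]
    · rw [h1] at hz
      linarith [hlt (n + m) (by omega)]
    · have hconst : ∀ n ≥ m, lift (h n) z / lift (T n) z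
          = (h m : 𝔻 → ℂ) z / (T m : 𝔻 → ℂ) z := by
        intro n hn
        induction n, hn using Nat.le_induction with
        | base => rw [lift_coe, lift_coe]
        | succ n hn ih =>
          have hb : blaschkeFactor (a n) z ≠ 0 := by
            rw [Ne, blaschkeFactor_eq_zero_iff]
            rintro rfl
            linarith [hlt n hn]
          rw [← ih, lift_coe, lift_coe, lift_coe, lift_coe, hh n, hTstep n, mul_apply, mul_apply,
            blaschke_apply, mul_div_mul_left _ _ hb]
      exact (tendsto_const_nhds.congr' (eventually_atTop.2 ⟨m, fun n hn =>
        (hconst n hn).symm⟩)).limUnder_eq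
  have hdiff : DifferentiableOn ℂ Q (ball 0 1) := by
    intro z hz
    have hz1 : ‖z‖ < 1 := mem_ball_zero_iff.1 hz
    obtain ⟨m, hm⟩ := key ((1 + ‖z‖) / 2) (by linarith)
    have hU : ball (0 : ℂ) ((1 + ‖z‖) / 2) ∈ 𝓝 z :=
      isOpen_ball.mem_nhds (mem_ball_zero_iff.2 (by linarith))
    have heq : Q =ᶠ[𝓝 z] fun w => lift (h m) w / lift (T m) w := by
      filter_upwards [hU] with w hw
      rw [mem_ball_zero_iff] at hw
      have hw1 : ‖w‖ < 1 := by linarith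
      rw [lift_of_norm_lt_one _ hw1, lift_of_norm_lt_one _ hw1, ← (hm (.mk w hw1) hw.le).2.2,
        Complex.UnitDisc.coe_mk]
    have hnhds := isOpen_ball.mem_nhds hz
    refine (heq.differentiableAt_iff.2 (DifferentiableAt.fun_div
      ((differentiableOn_lift _).differentiableAt hnhds)
      ((differentiableOn_lift _).differentiableAt hnhds) ?_)).differentiableWithinAt
    rw [lift_of_norm_lt_one _ hz1]
    exact (hm (.mk z hz1) (by rw [Complex.UnitDisc.coe_mk]; linarith)).2.1
  have hQC (z : 𝔻) : ‖Q z‖ ≤ C := by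
    obtain ⟨m, hm⟩ := key _ z.norm_lt_one
    obtain ⟨-, h2, h3⟩ := hm z le_rfl
    rw [h3, norm_div, div_le_iff₀ (norm_pos_iff.2 h2), mul_comm]
    exact hbound m z
  refine ⟨B, ofDifferentiableOn Q hdiff C hQC, hB, fun z => ?_, ext fun z => ?_⟩ <;>
  obtain ⟨m, hm⟩ := key _ z.norm_lt_one <;>
  obtain ⟨h1, h2, h3⟩ := hm z le_rfl
  · rw [ofDifferentiableOn_apply, h3]
    exact div_ne_zero h1 h2
  · have hBm := hBT m
    have h0m := eq_prod_blaschke_mul hh 0 m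
    simp only [add_zero] at h0m
    rw [mul_apply, ofDifferentiableOn_apply, h3, hBm, h0m, mul_apply, mul_apply, mul_assoc,
      mul_div_cancel₀ _ h2]

end

theorem exists_zeroFree_norm_le_one_of_mem {P : Ideal HInfty} {f g : HInfty} (hg : g ∈ P)
    (h0 : ZeroFree g) (hgf : g ∣ f) :
    ∃ u ∈ P, u ∣ f ∧ ZeroFree u ∧ ∀ z : 𝔻, ‖(u : 𝔻 → ℂ) z‖ ≤ 1 := by
  obtain ⟨C, hC⟩ := exists_norm_le g
  have hC0 : 0 < C := (norm_pos_iff.2 (h0 0)).trans_le (hC 0)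
  have hCne : (C : ℂ) ≠ 0 := Complex.ofReal_ne_zero.2 hC0.ne'
  have happ (z : 𝔻) : ((algebraMap ℂ HInfty (C : ℂ)⁻¹ * g : HInfty) : 𝔻 → ℂ) z
      = (C : ℂ)⁻¹ * (g : 𝔻 → ℂ) z := rfl
  refine ⟨algebraMap ℂ HInfty (C : ℂ)⁻¹ * g, P.mul_mem_left _ hg, ?_, fun z => ?_, fun z => ?_⟩
  · refine (IsUnit.mul_left_dvd ?_).2 hgf
    exact (IsUnit.mk0 _ (inv_ne_zero hCne)).map (algebraMap ℂ HInfty)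
  · rw [happ]
    exact mul_ne_zero (inv_ne_zero hCne) (h0 z)
  · rw [happ, norm_mul, norm_inv, Complex.norm_real, Real.norm_of_nonneg hC0.le,
      inv_mul_le_iff₀ hC0, mul_one]
    exact hC z

/-- Every nonzero element of a free prime ideal has a divisor in the ideal that is an infinite
Blaschke product or is zero-free and bounded by `1`. -/
theorem exists_dvd_of_mem_of_isFree {P : Ideal HInfty} (hP : P.IsPrime) (hfree : IsFree P)
    {f : HInfty} (hf : f ∈ P) (hf0 : f ≠ 0) : ∃ u ∈ P, u ∣ f ∧
      ((∃ a : ℕ → 𝔻, IsBlaschkeProduct a u) ∨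
        (ZeroFree u ∧ ∀ z : 𝔻, ‖(u : 𝔻 → ℂ) z‖ ≤ 1)) := by
  by_cases hex : ∃ g ∈ P, g ∣ f ∧ ZeroFree g
  · obtain ⟨g, hg, hgf, h0⟩ := hex
    obtain ⟨u, hu, huf, h⟩ := exists_zeroFree_norm_le_one_of_mem hg h0 hgf
    exact ⟨u, hu, huf, .inr h⟩
  push Not at hex
  have hstep (g : {g : HInfty // g ∈ P ∧ g ∣ f}) : ∃ (a : 𝔻) (k : {g : HInfty // g ∈ P ∧ g ∣ f}),
      g.1 = blaschke a * k.1 ∧ ∀ z, (g.1 : 𝔻 → ℂ) z = 0 → ‖(a : ℂ)‖ ≤ ‖(z : ℂ)‖ := by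
    obtain ⟨g, hg, hgf⟩ := g
    obtain ⟨a, ha, hmin⟩ := exists_zero_of_minimal_norm (hex g hg hgf)
    obtain ⟨k, rfl⟩ := blaschke_dvd_of_apply_eq_zero ha
    exact ⟨a, ⟨k, (hP.mem_or_mem hg).resolve_left (blaschke_notMem_of_isFree hP hfree a),
      (dvd_mul_left _ _).trans hgf⟩, rfl, hmin⟩
  choose α κ hκ hmin using hstep
  let s : ℕ → {g : HInfty // g ∈ P ∧ g ∣ f} := fun n => κ^[n] ⟨f, hf, dvd_rfl⟩
  have hs (n : ℕ) : s (n + 1) = κ (s n) := Function.iterate_succ_apply' _ _ _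
  obtain ⟨B, G, hB, hG, hBG⟩ := exists_eq_blaschkeProduct_mul (h := fun n => (s n).1)
    (a := fun n => α (s n)) (fun n => by rw [hs]; exact hκ _) hf0 fun n => hmin _
  change f = B * G at hBG
  -- G is a zero-free divisor of f, which this case excludes from P.
  have hBP : B ∈ P := (hP.mem_or_mem (hBG ▸ hf)).resolve_right fun hGP =>
    hex G hGP ⟨B, by rw [hBG, mul_comm]⟩ hG
  exact ⟨B, hBP, ⟨G, hBG⟩, .inl ⟨_, hB⟩⟩

/-! ### Roots of zero-free functions -/

/-- Take φ a primitive of g' / g with φ(0) = log g(0); then g exp(-φ) has zero derivative and is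
constantly 1. -/
theorem ZeroFree.exists_exp_eq {g : HInfty} (hg : ZeroFree g) :
    ∃ φ : ℂ → ℂ, DifferentiableOn ℂ φ (ball 0 1) ∧
      ∀ z : 𝔻, Complex.exp (φ z) = (g : 𝔻 → ℂ) z := by
  have hG := differentiableOn_lift g
  have hG0 (z : ℂ) (hz : z ∈ ball (0 : ℂ) 1) : lift g z ≠ 0 := by
    rw [lift_of_norm_lt_one g (mem_ball_zero_iff.1 hz)]
    exact hg _
  obtain ⟨φ, hφ0, hφ⟩ := ((hG.deriv isOpen_ball).fun_div hG hG0).isExactOn_ball.with_val_at 0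
    (Complex.log (lift g 0))
  have hderiv (z : ℂ) (hz : z ∈ ball (0 : ℂ) 1) :
      HasDerivAt (fun w => lift g w * Complex.exp (-φ w)) 0 z := by
    have h1 := (hG.differentiableAt (isOpen_ball.mem_nhds hz)).hasDerivAt
    convert! h1.mul (hφ z hz).neg.cexp using 1
    field_simp [hG0 z hz]
    ring
  have h00 : (0 : ℂ) ∈ ball (0 : ℂ) 1 := mem_ball_self one_pos
  refine ⟨φ, fun z hz => (hφ z hz).differentiableAt.differentiableWithinAt, fun z => ?_⟩
  have h := isOpen_ball.is_const_of_deriv_eq_zero (convex_ball (0 : ℂ) 1).isPreconnected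
    (fun w hw => (hderiv w hw).differentiableAt.differentiableWithinAt)
    (fun w hw => (hderiv w hw).deriv) (mem_ball_zero_iff.2 z.norm_lt_one) h00
  simp only [hφ0] at h
  rw [Complex.exp_neg, Complex.exp_neg, Complex.exp_log (hG0 0 h00), mul_inv_cancel₀ (hG0 0 h00),
    mul_inv_eq_one₀ (Complex.exp_ne_zero _), lift_coe] at h
  exact h.symm

theorem norm_le_one_of_pow_eq {g r : HInfty} {n : ℕ} (hn : 0 < n) (hr : r ^ n = g)
    (hg : ∀ z, ‖(g : 𝔻 → ℂ) z‖ ≤ 1) (z : 𝔻) : ‖(r : 𝔻 → ℂ) z‖ ≤ 1 := by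
  have h := hg z
  rw [← hr, pow_apply, norm_pow] at h
  exact (pow_le_one_iff_of_nonneg (norm_nonneg _) hn.ne').1 h

/-- With g = exp φ, the roots exp(φ / n) tend to 1 uniformly on compact discs. Indices start at 0,
so the first disc is just the origin. -/
theorem ZeroFree.exists_roots {g : HInfty} (hg : ZeroFree g)
    (hg1 : ∀ z : 𝔻, ‖(g : 𝔻 → ℂ) z‖ ≤ 1) :
    ∃ (n : ℕ → ℕ) (r : ℕ → HInfty), StrictMono n ∧ (∀ k, 0 < n k ∧ r k ^ n k = g) ∧
      ∀ k : ℕ, ∀ z : 𝔻, ‖(z : ℂ)‖ ≤ 1 - 1 / ((k : ℝ) + 1) →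
        ‖1 - (r k : 𝔻 → ℂ) z‖ < 1 / 2 ^ (k + 1) := by
  obtain ⟨φ, hφ, hexp⟩ := hg.exists_exp_eq
  have hroot (n : ℕ) (hn : 0 < n) (z : 𝔻) :
      Complex.exp (φ z / n) ^ n = (g : 𝔻 → ℂ) z := by
    rw [← Complex.exp_nat_mul, mul_div_cancel₀ _ (Nat.cast_ne_zero.2 hn.ne'), hexp]
  have hbd (n : ℕ) (hn : 0 < n) (z : 𝔻) : ‖Complex.exp (φ z / n)‖ ≤ 1 := by
    refine (pow_le_one_iff_of_nonneg (norm_nonneg _) hn.ne').1 ?_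
    rw [← norm_pow, hroot n hn]
    exact hg1 z
  have hev (k : ℕ) : ∀ᶠ n : ℕ in atTop, 0 < n ∧ ∀ z : 𝔻, ‖(z : ℂ)‖ ≤ 1 - 1 / ((k : ℝ) + 1) →
      ‖1 - Complex.exp (φ z / n)‖ < 1 / 2 ^ (k + 1) := by
    have hk : 1 - 1 / ((k : ℝ) + 1) < 1 := sub_lt_self _ (by positivity)
    obtain ⟨M, hM⟩ := (isCompact_closedBall (0 : ℂ)
      (1 - 1 / ((k : ℝ) + 1))).exists_bound_of_continuousOn (hφ.continuousOn.mono (closedBall_subset_ball hk))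
    have hlim := tendsto_const_div_atTop_nhds_zero_nat M
    have hlim2 := hlim.const_mul 2
    rw [mul_zero] at hlim2
    filter_upwards [eventually_gt_atTop 0, hlim.eventually_le_const one_pos,
      hlim2.eventually_lt_const (u := 1 / 2 ^ (k + 1)) (by positivity)] with n hn h1 h2
    refine ⟨hn, fun z hz => ?_⟩
    have h3 : ‖φ z / n‖ ≤ M / n := by
      rw [norm_div, Complex.norm_natCast]
      gcongr
      exact hM z (mem_closedBall_zero_iff.2 hz)
    rw [norm_sub_rev]
    refine (Complex.norm_exp_sub_one_le (h3.trans h1)).trans_lt ?_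
    linarith
  obtain ⟨n, hmono, hn⟩ := extraction_forall_of_eventually hev
  exact ⟨n, fun k => ofDifferentiableOn (fun z => Complex.exp (φ z / n k))
    (hφ.div_const _).cexp 1 (hbd _ (hn k).1), hmono,
    fun k => ⟨(hn k).1, ext fun z => hroot _ (hn k).1 z⟩, fun k => (hn k).2⟩

/-- The product of roots, close to `1`, of a zero-free function in a prime ideal. -/
theorem ZeroFree.roots_mem_krullIntersection {g : HInfty} (hg : ZeroFree g)
    (hg1 : ∀ z : 𝔻, ‖(g : 𝔻 → ℂ) z‖ ≤ 1) {P : Ideal HInfty} (hP : P.IsPrime) (hgP : g ∈ P)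
    {n : ℕ → ℕ} {r : ℕ → HInfty} (hr : ∀ k, 0 < n k ∧ r k ^ n k = g)
    (hbound : ∀ k : ℕ, ∀ z : 𝔻, ‖(z : ℂ)‖ ≤ 1 - 1 / ((k : ℝ) + 1) →
      ‖1 - (r k : 𝔻 → ℂ) z‖ < 1 / 2 ^ (k + 1)) :
    (∀ k, r k ∈ P) ∧ ∃ h : HInfty,
      HasProdLocallyUniformly (fun k => (r k : 𝔻 → ℂ)) (h : 𝔻 → ℂ) ∧
      h ≠ 0 ∧ h ∈ krullIntersection P := by
  have hrP (k : ℕ) : r k ∈ P := hP.mem_of_pow_mem (n k) (by rwa [(hr k).2])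
  have hnm : NormallyMultipliable r := by
    refine ⟨fun k => norm_le_one_of_pow_eq (hr k).1 (hr k).2 hg1, fun ρ hρ => ?_⟩
    refine ⟨fun k => 1 / 2 ^ (k + 1), ?_, ?_⟩
    · simpa using (summable_nat_add_iff 1).2 summable_geometric_two
    -- The disc of radius ρ lies in the k-th disc only for large k, hence a bound that holds
    -- eventually.
    · filter_upwards [(tendsto_one_div_add_atTop_nhds_zero_nat (𝕜 := ℝ)).eventually_le_const
        (sub_pos.2 hρ)] with k hk z hz
      rw [norm_sub_rev]
      exact (hbound k z (by linarith)).le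
  obtain ⟨h, hlu, hprod, hne⟩ := hnm.exists_hasProd
  refine ⟨hrP, h, hlu, ?_, hnm.mem_krullIntersection hprod hrP⟩
  rintro rfl
  refine hne 0 (fun k h0 => hg 0 ?_) rfl
  rw [← (hr k).2, pow_apply, h0, zero_pow (hr k).1.ne']

/-! ### Krull intersections of prime ideals -/

theorem krullIntersection_ne_bot_of_isFree {P : Ideal HInfty} (hP : P.IsPrime)
    (hfree : IsFree P) (hP0 : P ≠ ⊥) : krullIntersection P ≠ ⊥ := by
  obtain ⟨f, hf, hf0⟩ := Submodule.exists_mem_ne_zero_of_ne_bot hP0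
  obtain ⟨u, hu, -, ⟨a, ha⟩ | ⟨h0, h1⟩⟩ := exists_dvd_of_mem_of_isFree hP hfree hf hf0
  · obtain ⟨N, hN⟩ := IsBlaschkeProduct.exists_tail_sum_le a
    obtain ⟨-, B, -, -, hB0, hB⟩ := ha.tails_mem_krullIntersection hP hfree hu hN
    exact (Submodule.ne_bot_iff _).2 ⟨B, hB, hB0⟩
  · obtain ⟨n, r, -, hr, hbound⟩ := h0.exists_roots h1
    obtain ⟨-, h, -, hh0, hh⟩ := h0.roots_mem_krullIntersection h1 hP hu hr hbound
    exact (Submodule.ne_bot_iff _).2 ⟨h, hh, hh0⟩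

theorem krullIntersection_eq_bot_iff {P : Ideal HInfty} (hP : P.IsPrime) (hP0 : P ≠ ⊥) :
    krullIntersection P = ⊥ ↔ P.IsMaximal ∧ ∃ z₀ : 𝔻, P = pointIdeal z₀ := by
  refine ⟨fun h => ?_, ?_⟩
  · obtain ⟨z₀, hz₀⟩ := Set.nonempty_iff_ne_empty.2 fun hfree =>
      krullIntersection_ne_bot_of_isFree hP hfree hP0 h
    have hPz := eq_pointIdeal_of_mem_zeroSet hP hP0 hz₀
    exact ⟨hPz ▸ pointIdeal_isMaximal z₀, z₀, hPz⟩
  · rintro ⟨-, z₀, rfl⟩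
    exact krullIntersection_pointIdeal z₀

end HInfty

theorem mainTheorem4 (P : Ideal HInfty) (hP : P.IsPrime) :
    -- the characterization
    (P ≠ ⊥ →
      (krullIntersection P = ⊥ ↔ P.IsMaximal ∧ ∃ z₀ : 𝔻, P = HInfty.pointIdeal z₀)) ∧
    (HInfty.IsFree P →
      -- at least one of the two constructions below applies
      (∀ f ∈ P, f ≠ 0 → ∃ u ∈ P, u ∣ f ∧
        ((∃ a : ℕ → 𝔻, HInfty.IsBlaschkeProduct a u) ∨
          (HInfty.ZeroFree u ∧ ∀ z : 𝔻, ‖(u : 𝔻 → ℂ) z‖ ≤ 1))) ∧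
      -- first construction: the product of tails of a Blaschke product
      (∀ B ∈ P, ∀ a : ℕ → 𝔻, HInfty.IsBlaschkeProduct a B →
        (∃ N : ℕ → ℕ, ∀ k, ∑' n, (1 - ‖(a (n + N k) : ℂ)‖ ^ 2) ≤ 1 / 2 ^ (k + 1)) ∧
        ∀ N : ℕ → ℕ, (∀ k, ∑' n, (1 - ‖(a (n + N k) : ℂ)‖ ^ 2) ≤ 1 / 2 ^ (k + 1)) →
          ∃ (T : ℕ → HInfty) (Bstar : HInfty),
            (∀ k, HInfty.IsBlaschkeProduct (fun n => a (n + N k)) (T k) ∧ T k ∈ P) ∧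
            HasProdLocallyUniformly (fun k => (T k : 𝔻 → ℂ)) (Bstar : 𝔻 → ℂ) ∧
            Bstar ≠ 0 ∧ Bstar ∈ krullIntersection P) ∧
      -- second construction: the product of roots of a zero-free function
      (∀ g ∈ P, HInfty.ZeroFree g → (∀ z : 𝔻, ‖(g : 𝔻 → ℂ) z‖ ≤ 1) →
        (∃ (n : ℕ → ℕ) (r : ℕ → HInfty), StrictMono n ∧ (∀ k, 0 < n k ∧ r k ^ n k = g) ∧
          ∀ k : ℕ, ∀ z : 𝔻, ‖(z : ℂ)‖ ≤ 1 - 1 / ((k : ℝ) + 1) →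
            ‖1 - (r k : 𝔻 → ℂ) z‖ < 1 / 2 ^ (k + 1)) ∧
        ∀ (n : ℕ → ℕ) (r : ℕ → HInfty), (∀ k, 0 < n k ∧ r k ^ n k = g) →
          (∀ k : ℕ, ∀ z : 𝔻, ‖(z : ℂ)‖ ≤ 1 - 1 / ((k : ℝ) + 1) →
            ‖1 - (r k : 𝔻 → ℂ) z‖ < 1 / 2 ^ (k + 1)) →
          (∀ k, r k ∈ P) ∧
          ∃ h : HInfty,
            HasProdLocallyUniformly (fun k => (r k : 𝔻 → ℂ)) (h : 𝔻 → ℂ) ∧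
            h ≠ 0 ∧ h ∈ krullIntersection P)) := by
  refine ⟨HInfty.krullIntersection_eq_bot_iff hP, fun hfree =>
    ⟨fun f hf hf0 => HInfty.exists_dvd_of_mem_of_isFree hP hfree hf hf0,
      fun B hBP a hB => ⟨HInfty.IsBlaschkeProduct.exists_tail_sum_le a, fun N hN =>
        hB.tails_mem_krullIntersection hP hfree hBP hN⟩,
      fun g hgP hg hg1 => ⟨hg.exists_roots hg1, fun n r hr hbound =>
        hg.roots_mem_krullIntersection hg1 hP hgP hr hbound⟩⟩⟩
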